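/- Let $R$ be an associative ring with $1$, let $\mathcal C=(\mathcal C,\Delta,\varepsilon)$ be a coassociative $R$-coring with counit (an $R$-bimodule with $R$-bilinear $\Delta:\mathcal C\to\mathcal C\otimes_R\mathcal C$, $\Delta(c)=\sum c_1\otimes c_2$, and $\varepsilon:\mathcal C\to R$), and let ${}^*\mathcal C=\mathrm{Hom}_{R-}(\mathcal C,R)$ be its left dual ring, with product $(f\star g)(c)=\sum g(c_1f(c_2))$ and the $R$-bimodule structure $(rf)(c)=f(cr)$, $(fr)(c)=f(c)r$. Let $\mathcal A$ be an associative $R$-ring, not necessarily with unity (an $R$-bimodule with an associative $R$-bilinear multiplication $\mathcal A\otimes_R\mathcal A\to\mathcal A$), and let $\kappa:\mathcal A\to{}^*\mathcal C$ be an $R$-bilinear multiplicative map (that is, $(\mathcal A,\mathcal C)$ is a measuring left $R$-pairing); write $\langle a,c\rangle=\kappa(a)(c)$. Right $\mathcal A$-modules are right $R$-modules $M$ with an associative action for which $m\mapsto[a\mapsto ma]$ is a right $R$-linear map $M\to\mathrm{Hom}_{-R}(\mathcal A,M)$, where $(fr)(a)=f(ra)$ for $f\in\mathrm{Hom}_{-R}(\mathcal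 A,M)$; morphisms are the $R$-linear and $\mathcal A$-linear maps. $M$ is unital if $M\mathcal A=M$ and $\mathcal A$-faithful if $m\mathcal A=0$ implies $m=0$. It is $\mathcal C$-rational if for every $m\in M$ there is $\sum m_i\otimes c_i\in M\otimes_R\mathcal C$ with $ma=\sum m_i\langle a,c_i\rangle$ for all $a\in\mathcal A$. Let $\mathrm{Rat}^{\mathcal C}(\widetilde{\mathcal M}_{\mathcal A})$ and $\mathrm{Rat}^{\mathcal C}(\mathcal M_{\mathcal A})$ be the full subcategories of the $\mathcal C$-rational right $\mathcal A$-modules that are $\mathcal A$-faithful, respectively unital. View $\mathcal C$ as a right $\mathcal A$-module by $c\leftharpoonup a=\sum c_1\langle a,c_2\rangle$, and let $\sigma[\mathcal C_{\mathcal A}]$ be the full subcategory of the unital right $\mathcal A$-modules that are isomorphic to a submodule of a quotient of a direct sum of copies of $\mathcal C$. The same notions are used for ${}^*\mathcal C$ in place of $\mathcal A$, with $\kappa=\mathrm{id}$. Let $\mathcal M^{\mathcal C}$ be the category of right $\mathcal C$-comodules with injective coaction $M\to M\otimes_R\mathcal C$, $m\mapsto\sum m_{<0>}\otimes m_{<1>}$,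 and colinear maps. Suppose that ${}_R\mathcal C$ is locally projective (for every surjective map $\pi:L\to N$ of left $R$-modules, every left $R$-linear $g:\mathcal C\to N$ and every finitely generated left $R$-submodule $F\subseteq\mathcal C$ there is a left $R$-linear $g':\mathcal C\to L$ with $\pi g'|_F=g|_F$) and that $\kappa(\mathcal A)\subseteq{}^*\mathcal C$ is dense in the finite topology (the topology induced by the product topology of $R^{\mathcal C}$, $R$ discrete). Then $$\mathcal M^{\mathcal C}\simeq\mathrm{Rat}^{\mathcal C}(\widetilde{\mathcal M}_{\mathcal A})=\mathrm{Rat}^{\mathcal C}(\mathcal M_{\mathcal A})=\sigma[\mathcal C_{\mathcal A}]\simeq\mathrm{Rat}^{\mathcal C}(\widetilde{\mathcal M}_{{}^*\mathcal C})=\mathrm{Rat}^{\mathcal C}(\mathcal M_{{}^*\mathcal C})=\sigma[\mathcal C_{{}^*\mathcal C}].$$ Here each $\simeq$ is an isomorphism of categories which is the identity on underlying $R$-modules and on underlying maps: from $\mathcal M^{\mathcal C}$ to the modules over $\mathcal A$ (respectively ${}^*\mathcal C$) it is given by $ma=\sum m_{<0>}\langle a,m_{<1>}\rangle$, and from the ${}^*\mathcal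 C$-modules to the $\mathcal A$-modules by restriction of scalars along $\kappa$. -/

import Mathlib

open CategoryTheory MulOpposite

universe u v w w₁ w₂ w₃ w₄

namespace CoringPairing

noncomputable section

/-! Throughout, `R` is an associative unital ring, a right `R`-module is a `Module Rᵐᵒᵖ`, and an
`R`-bimodule carries `Module R`, `Module Rᵐᵒᵖ` and `SMulCommClass R Rᵐᵒᵖ`. Thus `op r • m` is the
element usually written `m r`. -/

/-! ### The tensor product over a noncommutative ring -/

section Tensor

variable (R : Type u) [Ring R]

/-- The relations `m r ⊗ n = m ⊗ r n`. -/
def balancedRel (M : Type w₁) (N : Type w₂) [AddCommGroup M] [AddCommGroup N]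
    [Module Rᵐᵒᵖ M] [Module R N] : AddSubgroup (TensorProduct ℤ M N) :=
  AddSubgroup.closure {t | ∃ (m : M) (r : R) (n : N),
    t = TensorProduct.tmul ℤ (op r • m) n - TensorProduct.tmul ℤ m (r • n)}

/-- The tensor product `M ⊗_R N` of a right `R`-module and a left `R`-module: the abelian group
`M ⊗_ℤ N` modulo the relations `m r ⊗ n = m ⊗ r n`. -/
def Tensor (M : Type w₁) (N : Type w₂) [AddCommGroup M] [AddCommGroup N]
    [Module Rᵐᵒᵖ M] [Module R N] : Type (max w₁ w₂) :=
  TensorProduct ℤ M N ⧸ balancedRel R M N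

namespace Tensor

variable {M : Type w₁} {N : Type w₂} [AddCommGroup M] [AddCommGroup N]
  [Module Rᵐᵒᵖ M] [Module R N]

instance : AddCommGroup (Tensor R M N) :=
  inferInstanceAs (AddCommGroup (TensorProduct ℤ M N ⧸ balancedRel R M N))

/-- The pure tensor `m ⊗ n`. -/
def tmul (m : M) (n : N) : Tensor R M N :=
  QuotientAddGroup.mk' (balancedRel R M N) (TensorProduct.tmul ℤ m n)

theorem tmul_add (m : M) (n n' : N) : tmul R m (n + n') = tmul R m n + tmul R m n' := by
  exact (congrArg (QuotientAddGroup.mk' (balancedRel R M N)) (TensorProduct.tmul_add m n n')).trans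
    (map_add _ _ _)

theorem add_tmul (m m' : M) (n : N) : tmul R (m + m') n = tmul R m n + tmul R m' n := by
  exact (congrArg (QuotientAddGroup.mk' (balancedRel R M N)) (TensorProduct.add_tmul m m' n)).trans
    (map_add _ _ _)

theorem smul_tmul (m : M) (r : R) (n : N) : tmul R (op r • m) n = tmul R m (r • n) := by
  rw [← sub_eq_zero]
  exact (QuotientAddGroup.eq_zero_iff (N := balancedRel R M N) _).2
    (AddSubgroup.subset_closure ⟨m, r, n, rfl⟩)

/-- The pure tensor as a biadditive map. -/
def mk : M →+ N →+ Tensor R M N :=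
  AddMonoidHom.mk' (fun m => AddMonoidHom.mk' (tmul R m) (tmul_add R m))
    (fun m m' => AddMonoidHom.ext fun n => add_tmul R m m' n)

@[simp] theorem mk_apply (m : M) (n : N) : mk R m n = tmul R m n := rfl

/-- The universal property: a biadditive map with `f (m r) n = f m (r n)` factors. -/
def lift {P : Type w₃} [AddCommGroup P] (f : M →+ N →+ P)
    (hf : ∀ (m : M) (r : R) (n : N), f (op r • m) n = f m (r • n)) : Tensor R M N →+ P :=
  QuotientAddGroup.lift (balancedRel R M N)
    (TensorProduct.liftAddHom f (fun r m n => by simp)) (by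
      unfold balancedRel
      rw [AddSubgroup.closure_le]
      rintro _ ⟨m, r, n, rfl⟩
      change _ = _
      rw [map_sub, TensorProduct.liftAddHom_tmul, TensorProduct.liftAddHom_tmul, hf, sub_self])

@[simp] theorem lift_tmul {P : Type w₃} [AddCommGroup P] (f : M →+ N →+ P)
    (hf : ∀ (m : M) (r : R) (n : N), f (op r • m) n = f m (r • n)) (m : M) (n : N) :
    lift R f hf (tmul R m n) = f m n := rfl

@[elab_as_elim]
theorem induction {p : Tensor R M N → Prop} (t : Tensor R M N)
    (tmul : ∀ m n, p (tmul R m n)) (zero : p 0) (add : ∀ x y, p x → p y → p (x + y)) : p t := by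
  obtain ⟨t, rfl⟩ := QuotientAddGroup.mk'_surjective (balancedRel R M N) t
  induction t using TensorProduct.induction_on with
  | zero => rw [map_zero]; exact zero
  | tmul m n => exact tmul m n
  | add x y hx hy => rw [map_add]; exact add _ _ hx hy

theorem addHom_ext {P : Type w₃} [AddCommGroup P] {f g : Tensor R M N →+ P}
    (h : ∀ m n, f (tmul R m n) = g (tmul R m n)) : f = g := by
  ext t
  induction t using induction with
  | tmul m n => exact h m n
  | zero => simp
  | add x y hx hy => simp [hx, hy]

theorem addHom_congr {P : Type w₃} [AddCommGroup P] (f g : Tensor R M N →+ P)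
    (t : Tensor R M N) (h : ∀ m n, f (tmul R m n) = g (tmul R m n)) : f t = g t :=
  DFunLike.congr_fun (addHom_ext R h) t

/-- The map `f ⊗ g`. -/
def map {M' : Type w₃} {N' : Type w₄} [AddCommGroup M'] [AddCommGroup N']
    [Module Rᵐᵒᵖ M'] [Module R N'] (f : M →ₗ[Rᵐᵒᵖ] M') (g : N →ₗ[R] N') :
    Tensor R M N →+ Tensor R M' N' :=
  lift R (AddMonoidHom.mk' (fun m => (mk R (f m)).comp g.toAddMonoidHom)
      (fun m m' => by ext n; simp))
    (fun m r n => by simp [smul_tmul])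

@[simp] theorem map_tmul {M' : Type w₃} {N' : Type w₄} [AddCommGroup M'] [AddCommGroup N']
    [Module Rᵐᵒᵖ M'] [Module R N'] (f : M →ₗ[Rᵐᵒᵖ] M') (g : N →ₗ[R] N') (m : M) (n : N) :
    map R f g (tmul R m n) = tmul R (f m) (g n) := rfl

section Right

variable [Module Rᵐᵒᵖ N] [SMulCommClass R Rᵐᵒᵖ N]

/-- Right multiplication by `r` on the second factor. -/
def rsmul (r : Rᵐᵒᵖ) : Tensor R M N →+ Tensor R M N :=
  map R LinearMap.id
    { toFun := fun n => r • n
      map_add' := smul_add r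
      map_smul' := fun s n => (smul_comm s r n).symm }

/-- If `N` is a bimodule, then `M ⊗_R N` is a right module through `(m ⊗ n) r = m ⊗ n r`. -/
instance : Module Rᵐᵒᵖ (Tensor R M N) where
  smul r t := rsmul R r t
  one_smul t := by
    change rsmul R 1 t = AddMonoidHom.id _ t
    refine DFunLike.congr_fun (addHom_ext R fun m n => ?_) t
    change tmul R m ((1 : Rᵐᵒᵖ) • n) = _
    rw [one_smul]; rfl
  mul_smul r s t := by
    change rsmul R (r * s) t = ((rsmul R r).comp (rsmul R s)) t
    refine DFunLike.congr_fun (addHom_ext R fun m n => ?_) t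
    change tmul R m ((r * s) • n) = tmul R m (r • s • n)
    rw [mul_smul]
  smul_zero r := map_zero (rsmul R r)
  smul_add r := map_add (rsmul R r)
  add_smul r s t := by
    change rsmul R (r + s) t = (rsmul R r + rsmul R s : Tensor R M N →+ Tensor R M N) t
    refine DFunLike.congr_fun (addHom_ext R fun m n => ?_) t
    change tmul R m ((r + s) • n) = tmul R m (r • n) + tmul R m (s • n)
    rw [add_smul, tmul_add]
  zero_smul t := by
    change rsmul R 0 t = (0 : Tensor R M N →+ Tensor R M N) t
    refine DFunLike.congr_fun (addHom_ext R fun m n => ?_) t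
    change tmul R m ((0 : Rᵐᵒᵖ) • n) = 0
    rw [zero_smul]; exact map_zero (mk R m)

@[simp] theorem op_smul_tmul (r : Rᵐᵒᵖ) (m : M) (n : N) :
    r • tmul R m n = tmul R m (r • n) := rfl

end Right

section Left

variable [Module R M] [SMulCommClass R Rᵐᵒᵖ M]

/-- Left multiplication by `r` on the first factor. -/
def lsmul (r : R) : Tensor R M N →+ Tensor R M N :=
  map R
    { toFun := fun m => r • m
      map_add' := smul_add r
      map_smul' := fun s m => smul_comm r s m } LinearMap.id

/-- If `M` is a bimodule, then `M ⊗_R N` is a left module through `r (m ⊗ n) = r m ⊗ n`. -/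
instance : Module R (Tensor R M N) where
  smul r t := lsmul R r t
  one_smul t := by
    change lsmul R 1 t = AddMonoidHom.id _ t
    refine DFunLike.congr_fun (addHom_ext R fun m n => ?_) t
    change tmul R ((1 : R) • m) n = _
    rw [one_smul]; rfl
  mul_smul r s t := by
    change lsmul R (r * s) t = ((lsmul R r).comp (lsmul R s)) t
    refine DFunLike.congr_fun (addHom_ext R fun m n => ?_) t
    change tmul R ((r * s) • m) n = tmul R (r • s • m) n
    rw [mul_smul]
  smul_zero r := map_zero (lsmul R r)
  smul_add r := map_add (lsmul R r)
  add_smul r s t := by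
    change lsmul R (r + s) t = (lsmul R r + lsmul R s : Tensor R M N →+ Tensor R M N) t
    refine DFunLike.congr_fun (addHom_ext R fun m n => ?_) t
    change tmul R ((r + s) • m) n = tmul R (r • m) n + tmul R (s • m) n
    rw [add_smul, add_tmul]
  zero_smul t := by
    change lsmul R 0 t = (0 : Tensor R M N →+ Tensor R M N) t
    refine DFunLike.congr_fun (addHom_ext R fun m n => ?_) t
    change tmul R ((0 : R) • m) n = 0
    rw [zero_smul]; exact DFunLike.congr_fun (map_zero (mk R)) n

@[simp] theorem left_smul_tmul (r : R) (m : M) (n : N) :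
    r • tmul R m n = tmul R (r • m) n := rfl

end Left

/-- The map `t ↦ p ↦ assoc (t ⊗ p)`. -/
def assocAux [Module Rᵐᵒᵖ N] [SMulCommClass R Rᵐᵒᵖ N] {P : Type w₃} [AddCommGroup P]
    [Module R P] : Tensor R M N →+ P →+ Tensor R M (Tensor R N P) :=
  lift R
    (AddMonoidHom.mk'
      (fun m => AddMonoidHom.mk' (fun n => (mk R m).comp (mk R n))
        (fun n n' => by ext p; simp [tmul_add]))
      (fun m m' => by ext n p; simp))
    (fun m r n => by
      ext p
      change tmul R (op r • m) (tmul R n p) = tmul R m (tmul R (r • n) p)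
      rw [smul_tmul, left_smul_tmul])

/-- The associativity map `(M ⊗_R N) ⊗_R P → M ⊗_R (N ⊗_R P)`, `(m ⊗ n) ⊗ p ↦ m ⊗ (n ⊗ p)`. -/
def assoc [Module Rᵐᵒᵖ N] [SMulCommClass R Rᵐᵒᵖ N] {P : Type w₃} [AddCommGroup P] [Module R P] :
    Tensor R (Tensor R M N) P →+ Tensor R M (Tensor R N P) :=
  lift R (assocAux R)
    (fun t r p => by
      refine addHom_congr R (((assocAux R).flip p).comp (rsmul R (op r)))
        ((assocAux R).flip (r • p)) t fun m n => ?_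
      change tmul R m (tmul R (op r • n) p) = tmul R m (tmul R n (r • p))
      rw [smul_tmul])

@[simp] theorem assoc_tmul [Module Rᵐᵒᵖ N] [SMulCommClass R Rᵐᵒᵖ N] {P : Type w₃}
    [AddCommGroup P] [Module R P] (m : M) (n : N) (p : P) :
    assoc R (tmul R (tmul R m n) p) = tmul R m (tmul R n p) := rfl

/-- For `f ∈ Hom_{R-}(N, R)`, the map `M ⊗_R N → M`, `m ⊗ n ↦ m f(n)`. -/
def evalRight (f : N →ₗ[R] R) : Tensor R M N →+ M :=
  lift R (AddMonoidHom.mk'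
      (fun m => AddMonoidHom.mk' (fun n => op (f n) • m) (fun n n' => by simp [add_smul]))
      (fun m m' => by ext n; simp))
    (fun m r n => by simp [mul_smul])

@[simp] theorem evalRight_tmul (f : N →ₗ[R] R) (m : M) (n : N) :
    evalRight R f (tmul R m n) = op (f n) • m := rfl

/-- For `f ∈ Hom_{-R}(M, R)`, the map `M ⊗_R N → N`, `m ⊗ n ↦ f(m) n`. -/
def evalLeft (f : M →ₗ[Rᵐᵒᵖ] R) : Tensor R M N →+ N :=
  lift R (AddMonoidHom.mk'
      (fun m => AddMonoidHom.mk' (fun n => f m • n) (fun n n' => by simp))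
      (fun m m' => by ext n; simp [add_smul]))
    (fun m r n => by simp [mul_smul])

@[simp] theorem evalLeft_tmul (f : M →ₗ[Rᵐᵒᵖ] R) (m : M) (n : N) :
    evalLeft R f (tmul R m n) = f m • n := rfl

theorem evalRight_left_smul [Module R M] [SMulCommClass R Rᵐᵒᵖ M] (f : N →ₗ[R] R) (r : R)
    (t : Tensor R M N) : evalRight R f (r • t) = r • evalRight R f t := by
  induction t using induction with
  | tmul m n => simp [smul_comm]
  | zero => simp
  | add x y hx hy => simp [hx, hy]

end Tensor

end Tensor

/-! ### Rings over `R` and corings -/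

/-- An associative `R`-ring, not necessarily with unity: an `R`-bimodule `A` with an associative
multiplication which is `R`-bilinear on `A ⊗_R A`. -/
class RRing (R : Type u) (A : Type v) [Ring R] [NonUnitalRing A] [Module R A] [Module Rᵐᵒᵖ A] :
    Prop where
  smul_op_smul : ∀ (r s : R) (a : A), r • op s • a = op s • r • a
  smul_mul : ∀ (r : R) (a b : A), (r • a) * b = r • (a * b)
  mul_op_smul : ∀ (r : R) (a b : A), a * (op r • b) = op r • (a * b)
  op_smul_mul : ∀ (r : R) (a b : A), (op r • a) * b = a * (r • b)

/-- A morphism of `R`-rings (without unity): an `R`-bilinear multiplicative map. -/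
structure RRingHom (R : Type u) (A : Type v) (B : Type w) [Ring R]
    [NonUnitalRing A] [Module R A] [Module Rᵐᵒᵖ A]
    [NonUnitalRing B] [Module R B] [Module Rᵐᵒᵖ B] extends A →ₙ+* B where
  map_smul : ∀ (r : R) (a : A), toFun (r • a) = r • toFun a
  map_op_smul : ∀ (r : R) (a : A), toFun (op r • a) = op r • toFun a

/-- The identity morphism of an `R`-ring. -/
def RRingHom.id (R : Type u) (A : Type v) [Ring R]
    [NonUnitalRing A] [Module R A] [Module Rᵐᵒᵖ A] : RRingHom R A A where
  toNonUnitalRingHom := NonUnitalRingHom.id A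
  map_smul _ _ := rfl
  map_op_smul _ _ := rfl

/-- A coassociative `R`-coring with counit, on an `R`-bimodule `C`. -/
class Coring (R : Type u) (C : Type w) [Ring R] [AddCommGroup C] [Module R C] [Module Rᵐᵒᵖ C]
    [SMulCommClass R Rᵐᵒᵖ C] where
  /-- The comultiplication, with its right linearity. -/
  comul : C →ₗ[Rᵐᵒᵖ] Tensor R C C
  comul_smul : ∀ (r : R) (c : C), comul (r • c) = r • comul c
  /-- The counit, with its left linearity. -/
  counit : C →ₗ[R] R
  counit_op_smul : ∀ (r : R) (c : C), counit (op r • c) = counit c * r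
  coassoc : ∀ c : C,
    Tensor.assoc R (Tensor.map R comul LinearMap.id (comul c)) =
      Tensor.map R LinearMap.id { comul with map_smul' := comul_smul } (comul c)
  /-- `∑ c₁ ε(c₂) = c` -/
  counit_right : ∀ c : C, Tensor.evalRight R counit (comul c) = c
  /-- `∑ ε(c₁) c₂ = c` -/
  counit_left : ∀ c : C,
    Tensor.evalLeft R { counit with map_smul' := fun r c => counit_op_smul r.unop c } (comul c) = c

/-- The comultiplication as a left linear map. -/
def comulLeft (R : Type u) (C : Type w) [Ring R] [AddCommGroup C] [Module R C] [Module Rᵐᵒᵖ C]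
    [SMulCommClass R Rᵐᵒᵖ C] [Coring R C] : C →ₗ[R] Tensor R C C :=
  { (Coring.comul : C →ₗ[Rᵐᵒᵖ] Tensor R C C) with map_smul' := Coring.comul_smul }

section Coring

variable (R : Type u) (C : Type w) [Ring R] [AddCommGroup C] [Module R C]

/-- The left dual `*C = Hom_{R-}(C, R)`. -/
def LeftDual : Type (max u w) := C →ₗ[R] R

namespace LeftDual

instance : AddCommGroup (LeftDual R C) := inferInstanceAs (AddCommGroup (C →ₗ[R] R))

instance : FunLike (LeftDual R C) C R := inferInstanceAs (FunLike (C →ₗ[R] R) C R)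

variable {R C}

@[ext] theorem ext {f g : LeftDual R C} (h : ∀ c, f c = g c) : f = g := LinearMap.ext h

/-- The underlying linear map. -/
def toLin (f : LeftDual R C) : C →ₗ[R] R := f

@[simp] theorem toLin_apply (f : LeftDual R C) (c : C) : f.toLin c = f c := rfl
@[simp] theorem add_apply (f g : LeftDual R C) (c : C) : (f + g) c = f c + g c := rfl
@[simp] theorem zero_apply (c : C) : (0 : LeftDual R C) c = 0 := rfl
@[simp] theorem map_add' (f : LeftDual R C) (c d : C) : f (c + d) = f c + f d :=
  LinearMap.map_add f.toLin c d
@[simp] theorem map_smul' (f : LeftDual R C) (r : R) (c : C) : f (r • c) = r * f c :=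
  LinearMap.map_smul f.toLin r c

/-- The right action `(f r)(c) = f(c) r`. -/
instance : Module Rᵐᵒᵖ (LeftDual R C) := inferInstanceAs (Module Rᵐᵒᵖ (C →ₗ[R] R))

@[simp] theorem op_smul_apply (r : R) (f : LeftDual R C) (c : C) : (op r • f) c = f c * r := rfl

theorem evalRight_add {M : Type w₁} [AddCommGroup M] [Module Rᵐᵒᵖ M] (f g : LeftDual R C)
    (t : Tensor R M C) : Tensor.evalRight R (f + g).toLin t =
      Tensor.evalRight R f.toLin t + Tensor.evalRight R g.toLin t := by
  rw [← AddMonoidHom.add_apply]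
  refine DFunLike.congr_fun (Tensor.addHom_ext R fun m n => ?_) t
  simp [add_smul]

theorem evalRight_op_smul {M : Type w₁} [AddCommGroup M] [Module Rᵐᵒᵖ M] (r : R)
    (f : LeftDual R C) (t : Tensor R M C) :
    Tensor.evalRight R (op r • f).toLin t = op r • Tensor.evalRight R f.toLin t := by
  induction t using Tensor.induction with
  | tmul m n => simp [mul_smul]
  | zero => simp
  | add x y hx hy => simp only [map_add, smul_add, hx, hy]

theorem evalRight_map {M : Type w₁} {M' : Type w₂} [AddCommGroup M] [Module Rᵐᵒᵖ M]
    [AddCommGroup M'] [Module Rᵐᵒᵖ M'] (φ : M →ₗ[Rᵐᵒᵖ] M') (f : LeftDual R C)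
    (t : Tensor R M C) :
    Tensor.evalRight R f.toLin (Tensor.map R φ LinearMap.id t) =
      φ (Tensor.evalRight R f.toLin t) := by
  induction t using Tensor.induction with
  | tmul m n => simp
  | zero => simp
  | add x y hx hy => simp only [map_add, hx, hy]

variable [Module Rᵐᵒᵖ C] [SMulCommClass R Rᵐᵒᵖ C]

/-- The left action `(r f)(c) = f(c r)`. -/
instance : Module R (LeftDual R C) where
  smul r f :=
    ({ toFun := fun c => f (op r • c)
       map_add' := fun c d => by simp
       map_smul' := fun s c => by rw [← smul_comm]; simp } : C →ₗ[R] R)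
  one_smul f := by ext c; change f (op (1 : R) • c) = f c; simp
  mul_smul r s f := by
    ext c; change f (op (r * s) • c) = f (op s • op r • c); rw [op_mul, mul_smul]
  smul_zero r := by ext c; rfl
  smul_add r f g := by ext c; rfl
  add_smul r s f := by
    ext c; change f (op (r + s) • c) = f (op r • c) + f (op s • c)
    rw [MulOpposite.op_add, add_smul, map_add']
  zero_smul f := by
    ext c; change f (op (0 : R) • c) = 0
    rw [op_zero, zero_smul]; exact LinearMap.map_zero f.toLin

@[simp] theorem smul_apply (r : R) (f : LeftDual R C) (c : C) : (r • f) c = f (op r • c) := rfl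

theorem evalRight_smul {M : Type w₁} [AddCommGroup M] [Module Rᵐᵒᵖ M] (r : R)
    (f : LeftDual R C) (t : Tensor R M C) :
    Tensor.evalRight R (r • f).toLin t = Tensor.evalRight R f.toLin (op r • t) := by
  induction t using Tensor.induction with
  | tmul m n => simp
  | zero => simp
  | add x y hx hy => simp only [map_add, smul_add, hx, hy]

variable [Coring R C]

/-- The map `C → C`, `c ↦ ∑ c₁ f(c₂)`, as a left linear map. -/
def act (f : LeftDual R C) : C →ₗ[R] C where
  toFun c := Tensor.evalRight R f.toLin (Coring.comul c)
  map_add' c d := by rw [map_add, map_add]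
  map_smul' r c := by rw [Coring.comul_smul, Tensor.evalRight_left_smul]; rfl

/-- The product `(f ⋆ g)(c) = ∑ g(c₁ f(c₂))`. -/
instance : Mul (LeftDual R C) := ⟨fun f g => g.toLin.comp f.act⟩

theorem mul_apply (f g : LeftDual R C) (c : C) :
    (f * g) c = g (Tensor.evalRight R f.toLin (Coring.comul c)) := rfl

/-- If `ϱ : M → M ⊗_R C` is coassociative, then `m · a = ∑ m₀ a(m₁)` is an action of `*C`. -/
theorem evalRight_mul {M : Type w₁} [AddCommGroup M] [Module Rᵐᵒᵖ M]
    (ϱ : M →ₗ[Rᵐᵒᵖ] Tensor R M C)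
    (h : ∀ m, Tensor.assoc R (Tensor.map R ϱ LinearMap.id (ϱ m)) =
      Tensor.map R LinearMap.id (comulLeft R C) (ϱ m)) (f g : LeftDual R C) (m : M) :
    Tensor.evalRight R (f * g).toLin (ϱ m) =
      Tensor.evalRight R g.toLin (ϱ (Tensor.evalRight R f.toLin (ϱ m))) := by
  let E : Tensor R C C →ₗ[R] R :=
    { toFun := fun t => g (Tensor.evalRight R f.toLin t)
      map_add' := fun s t => by simp
      map_smul' := fun r t => by simp [Tensor.evalRight_left_smul] }
  have h1 : ∀ t : Tensor R M C, Tensor.evalRight R E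
      (Tensor.map R LinearMap.id (comulLeft R C) t) = Tensor.evalRight R (f * g).toLin t := by
    intro t
    exact Tensor.addHom_congr R ((Tensor.evalRight R E).comp
      (Tensor.map R LinearMap.id (comulLeft R C))) (Tensor.evalRight R (f * g).toLin) t
      fun m n => rfl
  have h2 : ∀ t : Tensor R (Tensor R M C) C, Tensor.evalRight R E (Tensor.assoc R t) =
      Tensor.evalRight R g.toLin (Tensor.evalRight R f.toLin t) := by
    intro t
    refine Tensor.addHom_congr R ((Tensor.evalRight R E).comp (Tensor.assoc R))
      ((Tensor.evalRight R g.toLin).comp (Tensor.evalRight R f.toLin)) t fun s c => ?_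
    simp only [AddMonoidHom.comp_apply]
    induction s using Tensor.induction with
    | tmul m n => simp [E]
    | zero => rw [show Tensor.tmul R (0 : Tensor R M C) c = 0 from
        DFunLike.congr_fun (map_zero (Tensor.mk R)) c]; simp only [map_zero]
    | add x y hx hy => rw [Tensor.add_tmul]; simp only [map_add, hx, hy]
  rw [← h1, ← h, h2, evalRight_map]

/-- `(*C, ⋆)` is an associative ring. -/
instance : NonUnitalRing (LeftDual R C) where
  left_distrib f g h := by ext c; rfl
  right_distrib f g h := by
    ext c
    simp only [mul_apply, add_apply, evalRight_add, map_add']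
  zero_mul f := by
    ext c
    have h : Tensor.evalRight R (0 : LeftDual R C).toLin (Coring.comul c) = 0 := by
      have := evalRight_add (0 : LeftDual R C) 0 (Coring.comul c)
      rwa [add_zero, left_eq_add] at this
    rw [mul_apply, h]; exact LinearMap.map_zero f.toLin
  mul_zero f := by ext c; rfl
  mul_assoc f g h := by
    ext c
    rw [mul_apply, mul_apply, mul_apply]
    exact congrArg h (evalRight_mul Coring.comul Coring.coassoc f g c)

/-- `(*C, ⋆)` is an `R`-ring. -/
instance : RRing R (LeftDual R C) where
  smul_op_smul r s f := rfl
  smul_mul r f g := by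
    ext c
    rw [mul_apply, evalRight_smul, smul_apply, mul_apply, LinearMap.map_smul]
  mul_op_smul r f g := rfl
  op_smul_mul r f g := by
    ext c
    rw [mul_apply, evalRight_op_smul, mul_apply, smul_apply]

end LeftDual

/-- The finite topology on `*C`: the topology induced by the product topology on `R^C`, where
`R` is discrete. -/
@[reducible] def finiteTopology : TopologicalSpace (LeftDual R C) :=
  TopologicalSpace.induced (fun f c => f c) (@Pi.topologicalSpace C (fun _ => R) (fun _ => ⊥))

end Coring

/-- Local projectivity of a left `R`-module `W`: for every surjection `π : L → N`, every
`g : W → N` and every finitely generated `F ⊆ W` there is `g' : W → L` with `π ∘ g' = g` on `F`. -/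
def IsLocallyProjective (R : Type u) (W : Type w) [Ring R] [AddCommGroup W] [Module R W] : Prop :=
  ∀ (L N : Type (max u w)) [AddCommGroup L] [AddCommGroup N] [Module R L] [Module R N]
    (π : L →ₗ[R] N) (g : W →ₗ[R] N) (F : Submodule R W),
    Function.Surjective π → F.FG → ∃ g' : W →ₗ[R] L, ∀ x ∈ F, π (g' x) = g x

/-! ### Right modules over an `R`-ring -/

section Modules

variable (R : Type u) (A : Type v) [Ring R] [NonUnitalRing A] [Module R A] [Module Rᵐᵒᵖ A]

/-- A right module over an `R`-ring `A` without unity: a right `R`-module with an associative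
action of `A` for which `m ↦ [a ↦ m a]` is a right `R`-linear map `M → Hom_{-R}(A, M)`. -/
structure RightMod where
  carrier : Type w
  [addCommGroup : AddCommGroup carrier]
  [module : Module Rᵐᵒᵖ carrier]
  act : carrier →+ A →+ carrier
  act_op_smul : ∀ (m : carrier) (a : A) (r : R), act m (op r • a) = op r • act m a
  op_smul_act : ∀ (m : carrier) (a : A) (r : R), act (op r • m) a = act m (r • a)
  act_mul : ∀ (m : carrier) (a b : A), act m (a * b) = act (act m a) b

attribute [instance] RightMod.addCommGroup RightMod.module

variable {R A}

namespace RightMod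

/-- An `A`-linear map (which is also right `R`-linear). -/
@[ext] structure Hom (M N : RightMod.{u, v, w} R A) where
  toLin : M.carrier →ₗ[Rᵐᵒᵖ] N.carrier
  map_act : ∀ m a, toLin (M.act m a) = N.act (toLin m) a

instance : Category (RightMod.{u, v, w} R A) where
  Hom := Hom
  id M := ⟨LinearMap.id, fun _ _ => rfl⟩
  comp f g := ⟨g.toLin.comp f.toLin, fun m a => by
    simp only [LinearMap.comp_apply, f.map_act, g.map_act]⟩

/-- `M` is unital: `M A = M`. -/
def IsUnital (M : RightMod.{u, v, w} R A) : Prop :=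
  AddSubgroup.closure {x : M.carrier | ∃ m a, x = M.act m a} = ⊤

/-- `M` is `A`-faithful: `m ↦ [a ↦ m a]` is injective. -/
def IsFaithful (M : RightMod.{u, v, w} R A) : Prop :=
  Function.Injective fun (m : M.carrier) (a : A) => M.act m a

/-- The direct sum `K^(Λ)`. -/
def directSum (K : RightMod.{u, v, w} R A) (Λ : Type w) : RightMod.{u, v, w} R A where
  carrier := Λ →₀ K.carrier
  act := AddMonoidHom.mk'
    (fun x => AddMonoidHom.mk'
      (fun a => x.mapRange (fun k => K.act k a) (by simp))
      (fun a b => by ext i; simp))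
    (fun x y => by ext a i; simp)
  act_op_smul x a r := by ext i; simp [K.act_op_smul]
  op_smul_act x a r := by ext i; simp [K.op_smul_act]
  act_mul x a b := by ext i; simp [K.act_mul]

/-- `G` is `K`-generated: a quotient of a direct sum of copies of `K`. -/
def IsGenerated (K G : RightMod.{u, v, w} R A) : Prop :=
  ∃ (Λ : Type w) (p : K.directSum Λ ⟶ G), Function.Surjective (Hom.toLin p)

/-- `N` is `K`-subgenerated: isomorphic to a submodule of a `K`-generated module. -/
def IsSubgenerated (K N : RightMod.{u, v, w} R A) : Prop :=
  ∃ (G : RightMod.{u, v, w} R A) (i : N ⟶ G), K.IsGenerated G ∧ Function.Injective (Hom.toLin i)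

/-- `σ[K_A]`: the full subcategory of the unital modules that are `K`-subgenerated. -/
def sigma (K : RightMod.{u, v, w} R A) : ObjectProperty (RightMod.{u, v, w} R A) :=
  fun N => N.IsUnital ∧ K.IsSubgenerated N

/-- Restriction of scalars along a morphism of `R`-rings. -/
def restrict {A' : Type w₁} [NonUnitalRing A'] [Module R A'] [Module Rᵐᵒᵖ A']
    (κ : RRingHom R A A') : RightMod.{u, w₁, w} R A' ⥤ RightMod.{u, v, w} R A where
  obj M :=
    { carrier := M.carrier
      act := AddMonoidHom.mk' (fun m => (M.act m).comp κ.toNonUnitalRingHom.toAddMonoidHom)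
        (fun m m' => by ext a; simp)
      act_op_smul := fun m a r =>
        (congrArg (M.act m) (κ.map_op_smul r a)).trans (M.act_op_smul m _ r)
      op_smul_act := fun m a r =>
        (M.op_smul_act m _ r).trans (congrArg (M.act m) (κ.map_smul r a).symm)
      act_mul := fun m a b =>
        (congrArg (M.act m) (κ.map_mul' a b)).trans (M.act_mul m _ _) }
  map f := ⟨f.toLin, fun m a => f.map_act m _⟩

end RightMod

end Modules

/-! ### Comodules -/

section Comodules

variable (R : Type u) (C : Type w) [Ring R] [AddCommGroup C] [Module R C] [Module Rᵐᵒᵖ C]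
  [SMulCommClass R Rᵐᵒᵖ C] [Coring R C]

/-- A counital right `C`-comodule: a right `R`-module with an injective coassociative coaction. -/
structure Comod where
  carrier : Type w
  [addCommGroup : AddCommGroup carrier]
  [module : Module Rᵐᵒᵖ carrier]
  coact : carrier →ₗ[Rᵐᵒᵖ] Tensor R carrier C
  coassoc : ∀ m : carrier, Tensor.assoc R (Tensor.map R coact LinearMap.id (coact m)) =
    Tensor.map R LinearMap.id (comulLeft R C) (coact m)
  counital : Function.Injective coact

attribute [instance] Comod.addCommGroup Comod.module

variable {R C}

namespace Comod

/-- A colinear map. -/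
@[ext] structure Hom (M N : Comod R C) where
  toLin : M.carrier →ₗ[Rᵐᵒᵖ] N.carrier
  map_coact : ∀ m, N.coact (toLin m) = Tensor.map R toLin LinearMap.id (M.coact m)

/-- The category `M^C` of counital right `C`-comodules. -/
instance : Category (Comod R C) where
  Hom := Hom
  id M := ⟨LinearMap.id, fun m => by
    exact Tensor.addHom_congr R (AddMonoidHom.id _) (Tensor.map R LinearMap.id LinearMap.id)
      (M.coact m) fun _ _ => rfl⟩
  comp f g := ⟨g.toLin.comp f.toLin, fun m => by
    rw [LinearMap.comp_apply, g.map_coact, f.map_coact]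
    exact Tensor.addHom_congr R ((Tensor.map R g.toLin LinearMap.id).comp
      (Tensor.map R f.toLin LinearMap.id)) (Tensor.map R (g.toLin.comp f.toLin) LinearMap.id) _
      fun _ _ => rfl⟩

variable (R C) in
/-- `C` as a right comodule over itself. -/
def regular : Comod R C where
  carrier := C
  coact := Coring.comul
  coassoc := Coring.coassoc
  counital c d h := by rw [← Coring.counit_right (R := R) c, h, Coring.counit_right]

end Comod

end Comodules

/-! ### Measuring pairings and rational modules -/

/-- The measuring pairing `(*C, C)`. -/
def selfPairing (R : Type u) (C : Type w) [Ring R] [AddCommGroup C] [Module R C] [Module Rᵐᵒᵖ C]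
    [SMulCommClass R Rᵐᵒᵖ C] [Coring R C] : RRingHom R (LeftDual R C) (LeftDual R C) :=
  RRingHom.id R (LeftDual R C)

section Pairing

variable {R : Type u} {A : Type v} {C : Type w} [Ring R]
  [NonUnitalRing A] [Module R A] [Module Rᵐᵒᵖ A]
  [AddCommGroup C] [Module R C] [Module Rᵐᵒᵖ C] [SMulCommClass R Rᵐᵒᵖ C] [Coring R C]

/-- The map `α_M : M ⊗_R C → Hom(A, M)`, `m ⊗ c ↦ [a ↦ m ⟨a, c⟩]`, where `⟨a, c⟩ = κ(a)(c)`. -/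
def alpha (κ : RRingHom R A (LeftDual R C)) {M : Type w₁} [AddCommGroup M] [Module Rᵐᵒᵖ M]
    (t : Tensor R M C) (a : A) : M :=
  Tensor.evalRight R (κ.toNonUnitalRingHom a).toLin t

theorem alpha_add (κ : RRingHom R A (LeftDual R C)) {M : Type w₁} [AddCommGroup M]
    [Module Rᵐᵒᵖ M] (t : Tensor R M C) (a b : A) : alpha κ t (a + b) = alpha κ t a + alpha κ t b := by
  unfold alpha
  rw [map_add, LeftDual.evalRight_add]

theorem add_alpha (κ : RRingHom R A (LeftDual R C)) {M : Type w₁} [AddCommGroup M]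
    [Module Rᵐᵒᵖ M] (s t : Tensor R M C) (a : A) : alpha κ (s + t) a = alpha κ s a + alpha κ t a :=
  map_add _ s t

theorem alpha_op_smul (κ : RRingHom R A (LeftDual R C)) {M : Type w₁} [AddCommGroup M]
    [Module Rᵐᵒᵖ M] (t : Tensor R M C) (a : A) (r : R) :
    alpha κ t (op r • a) = op r • alpha κ t a := by
  have h : κ.toNonUnitalRingHom (op r • a) = op r • κ.toNonUnitalRingHom a := κ.map_op_smul r a
  unfold alpha
  rw [h, LeftDual.evalRight_op_smul]

theorem op_smul_alpha (κ : RRingHom R A (LeftDual R C)) {M : Type w₁} [AddCommGroup M]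
    [Module Rᵐᵒᵖ M] (t : Tensor R M C) (a : A) (r : R) :
    alpha κ (op r • t) a = alpha κ t (r • a) := by
  have h : κ.toNonUnitalRingHom (r • a) = r • κ.toNonUnitalRingHom a := κ.map_smul r a
  unfold alpha
  rw [h, LeftDual.evalRight_smul]

/-- The right `A`-module of a counital comodule: `m a = ∑ m₀ ⟨a, m₁⟩`. -/
@[reducible] def Comod.toRightMod (κ : RRingHom R A (LeftDual R C)) (M : Comod R C) :
    RightMod.{u, v, w} R A where
  carrier := M.carrier
  act := AddMonoidHom.mk'
    (fun m => AddMonoidHom.mk' (fun a => alpha κ (M.coact m) a) (alpha_add κ _))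
    (fun m m' => AddMonoidHom.ext fun a =>
      (congrArg (fun t => alpha κ t a) (M.coact.map_add m m')).trans (add_alpha κ _ _ a))
  act_op_smul m a r := alpha_op_smul κ _ a r
  op_smul_act m a r :=
    (congrArg (fun t => alpha κ t a) (M.coact.map_smul (op r) m)).trans (op_smul_alpha κ _ a r)
  act_mul m a b := by
    change alpha κ (M.coact m) (a * b) = alpha κ (M.coact (alpha κ (M.coact m) a)) b
    unfold alpha
    rw [map_mul, LeftDual.evalRight_mul M.coact M.coassoc]

theorem Comod.Hom.map_alpha (κ : RRingHom R A (LeftDual R C)) {M N : Comod R C} (f : Comod.Hom M N)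
    (m : M.carrier) (a : A) :
    f.toLin (alpha κ (M.coact m) a) = alpha κ (N.coact (f.toLin m)) a := by
  rw [f.map_coact]
  exact (LeftDual.evalRight_map f.toLin _ _).symm

/-- The functor from counital comodules to right `A`-modules, `m a = ∑ m₀ ⟨a, m₁⟩`, which is the
identity on the underlying `R`-modules and on morphisms. -/
@[reducible] def comodToMod (κ : RRingHom R A (LeftDual R C)) : Comod R C ⥤ RightMod.{u, v, w} R A where
  obj M := M.toRightMod κ
  map f := ⟨f.toLin, f.map_alpha κ⟩

/-- `C` as a right `A`-module, `c ↼ a = ∑ c₁ ⟨a, c₂⟩`. -/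
def coringMod (κ : RRingHom R A (LeftDual R C)) : RightMod.{u, v, w} R A :=
  (comodToMod κ).obj (Comod.regular R C)

/-- `Rat^C(M)`: the `m ∈ M` for which there is `∑ mᵢ ⊗ cᵢ ∈ M ⊗_R C` with
`m a = ∑ mᵢ ⟨a, cᵢ⟩` for all `a`. -/
def ratPart (κ : RRingHom R A (LeftDual R C)) (M : RightMod.{u, v, w} R A) : Set M.carrier :=
  {m | ∃ t : Tensor R M.carrier C, ∀ a, M.act m a = alpha κ t a}

/-- The full subcategory of the `A`-faithful right `A`-modules `M` that are `C`-rational, i.e.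
`Rat^C(M) = M`. -/
def ratFaithful (κ : RRingHom R A (LeftDual R C)) : ObjectProperty (RightMod.{u, v, w} R A) :=
  fun M => M.IsFaithful ∧ ratPart κ M = Set.univ

/-- The full subcategory of the unital right `A`-modules `M` that are `C`-rational, i.e.
`Rat^C(M) = M`. -/
def ratUnital (κ : RRingHom R A (LeftDual R C)) : ObjectProperty (RightMod.{u, v, w} R A) :=
  fun M => M.IsUnital ∧ ratPart κ M = Set.univ

end Pairing

/-- `F` is an isomorphism of categories (not just an equivalence). -/
def IsCatIso {𝒞 : Type w₁} {𝒟 : Type w₂} [Category.{w₃} 𝒞] [Category.{w₄} 𝒟] (F : 𝒞 ⥤ 𝒟) : Prop :=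
  ∃ G : 𝒟 ⥤ 𝒞, F ⋙ G = 𝟭 𝒞 ∧ G ⋙ F = 𝟭 𝒟

end

end CoringPairing

namespace CoringPairing

open Filter
open scoped Topology

/-!
Two facts carry the argument. For a tensor `t ∈ M ⊗_R C`, the value of `id ⊗ f` at `t` is locally
constant in `f ∈ *C` for the finite topology, so every such value is attained on a dense subset;
and local projectivity provides finite dual bases, so `t` is determined by these values. Hence, for
a dense pairing, `α_M : M ⊗_R C → Hom(A, M)` is injective, and a rational module carries a unique
`R`-linear `ϱ : M → M ⊗_R C` with `m a = (id ⊗ κ(a)) (ϱ m)`. Under `α`, associativity of the action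
becomes `A`-linearity of `ϱ`, which is in turn coassociativity of `ϱ`; it also embeds `M` into the
`C`-generated module `M ⊗_R C`. The elements of `A` close to the counit act as an approximate unit
on a rational module which is faithful or unital, so the two conditions agree. Finally,
restriction along `κ` turns the functor from comodules to `*C`-modules into the one to `A`-modules,
so it is an isomorphism because these two are.
-/

section Tensor

variable {R : Type u} [Ring R] {M : Type w₁} {N : Type w₂} [AddCommGroup M] [AddCommGroup N]
  [Module Rᵐᵒᵖ M] [Module R N]

namespace Tensor

theorem zero_tmul (n : N) : tmul R (0 : M) n = 0 :=
  DFunLike.congr_fun (map_zero (mk R)) n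

theorem tmul_zero (m : M) : tmul R m (0 : N) = 0 :=
  map_zero (mk R m)

theorem sum_tmul {ι : Type*} (s : Finset ι) (m : ι → M) (n : N) :
    tmul R (∑ i ∈ s, m i) n = ∑ i ∈ s, tmul R (m i) n :=
  map_sum ((mk R).flip n) m s

theorem tmul_sum {ι : Type*} (s : Finset ι) (m : M) (n : ι → N) :
    tmul R m (∑ i ∈ s, n i) = ∑ i ∈ s, tmul R m (n i) :=
  map_sum (mk R m) n s

theorem exists_finset (t : Tensor R M N) : ∃ S : Finset (M × N), t = ∑ p ∈ S, tmul R p.1 p.2 := by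
  obtain ⟨t, rfl⟩ := QuotientAddGroup.mk'_surjective (balancedRel R M N) t
  obtain ⟨S, rfl⟩ := TensorProduct.exists_finset t
  exact ⟨S, map_sum (QuotientAddGroup.mk' (balancedRel R M N)) _ S⟩

theorem evalRight_map_id {N' : Type w₃} [AddCommGroup N'] [Module R N'] (f : N' →ₗ[R] R)
    (g : N →ₗ[R] N') (t : Tensor R M N) :
    evalRight R f (map R LinearMap.id g t) = evalRight R (f ∘ₗ g) t :=
  addHom_congr R ((evalRight R f).comp (map R LinearMap.id g)) (evalRight R (f ∘ₗ g)) t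
    fun _ _ => rfl

theorem map_id_map_id {N' : Type w₃} {N'' : Type w₄} [AddCommGroup N'] [Module R N']
    [AddCommGroup N''] [Module R N''] (f : N' →ₗ[R] N'') (g : N →ₗ[R] N') (t : Tensor R M N) :
    map R LinearMap.id f (map R LinearMap.id g t) = map R LinearMap.id (f ∘ₗ g) t :=
  addHom_congr R ((map R LinearMap.id f).comp (map R LinearMap.id g))
    (map R LinearMap.id (f ∘ₗ g)) t fun _ _ => rfl

section Assoc

variable {P : Type w₃} [AddCommGroup P] [Module R P] [Module Rᵐᵒᵖ N] [SMulCommClass R Rᵐᵒᵖ N]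

theorem assoc_surjective :
    Function.Surjective (assoc R : Tensor R (Tensor R M N) P →+ Tensor R M (Tensor R N P)) := by
  intro t
  change t ∈ (assoc R).range
  induction t using Tensor.induction with
  | tmul m s =>
    induction s using Tensor.induction with
    | tmul n p => exact ⟨_, assoc_tmul R m n p⟩
    | zero => rw [tmul_zero]; exact zero_mem _
    | add x y hx hy => rw [tmul_add]; exact add_mem hx hy
  | zero => exact zero_mem _
  | add x y hx hy => exact add_mem hx hy

/-- For `f ∈ Hom_{R-}(P, R)` and a bimodule `N`, the map `N ⊗_R P → N`, `n ⊗ p ↦ n f(p)`, as a left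
linear map. -/
def evalRightLin (f : P →ₗ[R] R) : Tensor R N P →ₗ[R] N :=
  { evalRight R f with map_smul' := evalRight_left_smul R f }

theorem map_evalRightLin_assoc (f : P →ₗ[R] R) (t : Tensor R (Tensor R M N) P) :
    map R LinearMap.id (evalRightLin f) (assoc R t) = evalRight R f t := by
  refine addHom_congr R ((map R LinearMap.id (evalRightLin f)).comp (assoc R)) (evalRight R f) t
    fun s p => ?_
  exact addHom_congr R ((map R LinearMap.id (evalRightLin f)).comp ((assoc R).comp ((mk R).flip p)))
    ((evalRight R f).comp ((mk R).flip p)) s fun _ _ => rfl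

end Assoc

end Tensor

namespace IsLocallyProjective

theorem exists_dual_basis (hN : IsLocallyProjective R N) (F : Finset N) :
    ∃ (S : Finset N) (f : N → N →ₗ[R] R), ∀ n ∈ F, ∑ x ∈ S, f x n • x = n := by
  classical
  -- Lift the identity of `N` on the span of `F` to the free module on the elements of `N`.
  let up : N ≃ₗ[R] ULift.{max u w₂} N := ULift.moduleEquiv.symm
  let π : (N →₀ R) →ₗ[R] N := Finsupp.linearCombination R id
  obtain ⟨g, hg⟩ := hN (N →₀ R) (ULift.{max u w₂} N) (up.toLinearMap ∘ₗ π) up.toLinearMap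
    (Submodule.span R F) (up.surjective.comp (Finsupp.linearCombination_id_surjective R N)) ⟨F, rfl⟩
  refine ⟨F.biUnion fun n => (g n).support, fun x => Finsupp.lapply x ∘ₗ g, fun n hn => ?_⟩
  calc ∑ x ∈ F.biUnion fun n => (g n).support, g n x • x = π (g n) :=
        (Finsupp.sum_of_support_subset (g n)
          (Finset.subset_biUnion_of_mem (fun n => (g n).support) hn) (fun x r => r • x)
          fun x _ => zero_smul R x).symm
    _ = n := up.injective (hg n (Submodule.subset_span hn))

theorem exists_sum_tmul_evalRight_eq (hN : IsLocallyProjective R N) (t : Tensor R M N) :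
    ∃ (S : Finset N) (f : N → N →ₗ[R] R),
      ∑ x ∈ S, Tensor.tmul R (Tensor.evalRight R (f x) t) x = t := by
  classical
  obtain ⟨P, rfl⟩ := t.exists_finset
  obtain ⟨S, f, hf⟩ := hN.exists_dual_basis (P.image Prod.snd)
  refine ⟨S, f, ?_⟩
  calc ∑ x ∈ S, Tensor.tmul R (Tensor.evalRight R (f x) (∑ p ∈ P, Tensor.tmul R p.1 p.2)) x
      = ∑ x ∈ S, ∑ p ∈ P, Tensor.tmul R p.1 (f x p.2 • x) := by
        simp only [map_sum, Tensor.evalRight_tmul, Tensor.sum_tmul, Tensor.smul_tmul]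
    _ = ∑ p ∈ P, Tensor.tmul R p.1 (∑ x ∈ S, f x p.2 • x) := by
        rw [Finset.sum_comm]
        simp only [Tensor.tmul_sum]
    _ = ∑ p ∈ P, Tensor.tmul R p.1 p.2 :=
        Finset.sum_congr rfl fun p hp => by rw [hf p.2 (Finset.mem_image_of_mem _ hp)]

theorem eq_of_evalRight_eq (hN : IsLocallyProjective R N) {s t : Tensor R M N}
    (h : ∀ f : N →ₗ[R] R, Tensor.evalRight R f s = Tensor.evalRight R f t) : s = t := by
  obtain ⟨S, f, hf⟩ := hN.exists_sum_tmul_evalRight_eq (s - t)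
  rw [← sub_eq_zero, ← hf]
  refine Finset.sum_eq_zero fun x _ => ?_
  rw [map_sub, h, sub_self, Tensor.zero_tmul]

theorem exists_map_eq (hN : IsLocallyProjective R N) {M' : Type w₃} [AddCommGroup M']
    [Module Rᵐᵒᵖ M'] (i : M' →ₗ[Rᵐᵒᵖ] M) {t : Tensor R M N}
    (h : ∀ f : N →ₗ[R] R, ∃ m, i m = Tensor.evalRight R f t) :
    ∃ s : Tensor R M' N, Tensor.map R i LinearMap.id s = t := by
  obtain ⟨S, f, hf⟩ := hN.exists_sum_tmul_evalRight_eq t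
  choose m hm using fun x => h (f x)
  refine ⟨∑ x ∈ S, Tensor.tmul R (m x) x, ?_⟩
  simp only [map_sum, Tensor.map_tmul, hm, LinearMap.id_apply, hf]

theorem eq_of_map_evalRightLin_eq {P : Type w₃} [AddCommGroup P] [Module R P]
    [Module Rᵐᵒᵖ N] [SMulCommClass R Rᵐᵒᵖ N] (hP : IsLocallyProjective R P)
    {s t : Tensor R M (Tensor R N P)}
    (h : ∀ f : P →ₗ[R] R, Tensor.map R LinearMap.id (Tensor.evalRightLin f) s =
      Tensor.map R LinearMap.id (Tensor.evalRightLin f) t) : s = t := by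
  obtain ⟨s, rfl⟩ := Tensor.assoc_surjective s
  obtain ⟨t, rfl⟩ := Tensor.assoc_surjective t
  simp only [Tensor.map_evalRightLin_assoc] at h
  rw [hP.eq_of_evalRight_eq h]

end IsLocallyProjective

end Tensor

attribute [local instance] finiteTopology

namespace LeftDual

section FiniteTopology

variable {R : Type u} {C : Type w} [Ring R] [AddCommGroup C] [Module R C]

theorem eventually_apply_eq (f : LeftDual R C) (c : C) : ∀ᶠ g in 𝓝 f, g c = f c := by
  let : TopologicalSpace R := ⊥
  have : DiscreteTopology R := ⟨rfl⟩
  have hcont : Continuous fun g : LeftDual R C => g c :=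
    (continuous_apply c).comp continuous_induced_dom
  exact (hcont.isOpen_preimage {f c} (isOpen_discrete _)).mem_nhds rfl

theorem eventually_evalRight_eq {M : Type w₁} [AddCommGroup M] [Module Rᵐᵒᵖ M]
    (f : LeftDual R C) (t : Tensor R M C) :
    ∀ᶠ g in 𝓝 f, Tensor.evalRight R g.toLin t = Tensor.evalRight R f.toLin t := by
  induction t using Tensor.induction with
  | tmul m c =>
    filter_upwards [eventually_apply_eq f c] with g hg
    simp only [Tensor.evalRight_tmul, toLin_apply, hg]
  | zero => simp only [map_zero, eventually_true]
  | add x y hx hy =>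
    filter_upwards [hx, hy] with g hgx hgy
    rw [map_add, map_add, hgx, hgy]

end FiniteTopology

section Counit

variable {R : Type u} {C : Type w} [Ring R] [AddCommGroup C] [Module R C] [Module Rᵐᵒᵖ C]
  [SMulCommClass R Rᵐᵒᵖ C] [Coring R C] {M : Type w₁} [AddCommGroup M] [Module Rᵐᵒᵖ M]

theorem evalRight_mul_eq (f g : LeftDual R C) (t : Tensor R M C) :
    Tensor.evalRight R (f * g).toLin t =
      Tensor.evalRight R g.toLin (Tensor.map R LinearMap.id f.act t) :=
  (Tensor.evalRight_map_id g.toLin f.act t).symm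

theorem map_evalRightLin_comulLeft (f : LeftDual R C) (t : Tensor R M C) :
    Tensor.map R LinearMap.id (Tensor.evalRightLin f.toLin)
      (Tensor.map R LinearMap.id (comulLeft R C) t) = Tensor.map R LinearMap.id f.act t :=
  Tensor.map_id_map_id _ _ t

variable (R C) in
/-- The counit `ε` as an element of `*C`, where it is the unit of the product `⋆`. -/
def counit : LeftDual R C := (Coring.counit : C →ₗ[R] R)

theorem mul_counit (f : LeftDual R C) : f * counit R C = f := by
  ext c
  have h : ∀ t : Tensor R C C, counit R C (Tensor.evalRight R f.toLin t) =
      f (Tensor.evalLeft R { (Coring.counit : C →ₗ[R] R) with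
        map_smul' := fun r c => Coring.counit_op_smul r.unop c } t) := fun t =>
    Tensor.addHom_congr R
      ((counit R C).toLin.toAddMonoidHom.comp (Tensor.evalRight R f.toLin))
      (f.toLin.toAddMonoidHom.comp (Tensor.evalLeft R _)) t fun x y =>
        (Coring.counit_op_smul (f y) x).trans (f.map_smul' (Coring.counit x) y).symm
  exact (h (Coring.comul c)).trans (congrArg f (Coring.counit_left c))

theorem eventually_map_act_eq (f : LeftDual R C) (t : Tensor R M C) :
    ∀ᶠ g in 𝓝 f, Tensor.map R LinearMap.id g.act t = Tensor.map R LinearMap.id f.act t := by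
  induction t using Tensor.induction with
  | tmul m c =>
    filter_upwards [eventually_evalRight_eq f (Coring.comul c : Tensor R C C)] with g hg
    exact congrArg (Tensor.tmul R m) hg
  | zero => simp only [map_zero, eventually_true]
  | add x y hx hy =>
    filter_upwards [hx, hy] with g hgx hgy
    rw [map_add, map_add, hgx, hgy]

theorem map_counit_act (t : Tensor R M C) :
    Tensor.map R LinearMap.id (counit R C).act t = t :=
  Tensor.addHom_congr R (Tensor.map R LinearMap.id (counit R C).act) (AddMonoidHom.id _) t
    fun m c => congrArg (Tensor.tmul R m) (Coring.counit_right c)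

theorem eventually_evalRight_mul_eq (f : LeftDual R C) (t : Tensor R M C) :
    ∀ᶠ e in 𝓝 (counit R C),
      Tensor.evalRight R (f * e).toLin t = Tensor.evalRight R f.toLin t := by
  filter_upwards [eventually_evalRight_eq (counit R C) (Tensor.map R LinearMap.id f.act t)]
    with e he
  rw [evalRight_mul_eq, he, ← evalRight_mul_eq, mul_counit]

end Counit

end LeftDual

theorem IsLocallyProjective.coassoc_of_coact_evalRight {R : Type u} {C : Type w} {M : Type w₁}
    [Ring R] [AddCommGroup C] [Module R C] [Module Rᵐᵒᵖ C] [SMulCommClass R Rᵐᵒᵖ C] [Coring R C]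
    [AddCommGroup M] [Module Rᵐᵒᵖ M] (hC : IsLocallyProjective R C)
    (ϱ : M →ₗ[Rᵐᵒᵖ] Tensor R M C) {m : M}
    (h : ∀ f : LeftDual R C,
      ϱ (Tensor.evalRight R f.toLin (ϱ m)) = Tensor.map R LinearMap.id f.act (ϱ m)) :
    Tensor.assoc R (Tensor.map R ϱ LinearMap.id (ϱ m)) =
      Tensor.map R LinearMap.id (comulLeft R C) (ϱ m) := by
  refine hC.eq_of_map_evalRightLin_eq fun f : LeftDual R C => ?_
  calc Tensor.map R LinearMap.id (Tensor.evalRightLin f.toLin)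
        (Tensor.assoc R (Tensor.map R ϱ LinearMap.id (ϱ m)))
      = Tensor.evalRight R f.toLin (Tensor.map R ϱ LinearMap.id (ϱ m)) :=
        Tensor.map_evalRightLin_assoc f.toLin _
    _ = ϱ (Tensor.evalRight R f.toLin (ϱ m)) := f.evalRight_map ϱ _
    _ = Tensor.map R LinearMap.id f.act (ϱ m) := h f
    _ = Tensor.map R LinearMap.id (Tensor.evalRightLin f.toLin)
        (Tensor.map R LinearMap.id (comulLeft R C) (ϱ m)) :=
        (f.map_evalRightLin_comulLeft _).symm

section DenseRange

variable {X Y : Type*} [TopologicalSpace Y] {f : X → Y}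

theorem neBot_comap_nhds_of_denseRange (hf : DenseRange f) (y : Y) : (comap f (𝓝 y)).NeBot :=
  comap_neBot_iff_frequently.2 (mem_closure_iff_frequently.1 (hf y))

theorem exists_of_denseRange_of_eventually_nhds (hf : DenseRange f) {y : Y} {p : Y → Prop}
    (hp : ∀ᶠ z in 𝓝 y, p z) : ∃ x, p (f x) :=
  have := neBot_comap_nhds_of_denseRange hf y
  (hp.comap f).exists

end DenseRange

section Pairing

variable {R : Type u} {A : Type v} {C : Type w} [Ring R]
  [NonUnitalRing A] [Module R A] [Module Rᵐᵒᵖ A]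
  [AddCommGroup C] [Module R C] [Module Rᵐᵒᵖ C] [SMulCommClass R Rᵐᵒᵖ C] [Coring R C]
  {κ : RRingHom R A (LeftDual R C)}

theorem denseRange_selfPairing : DenseRange (selfPairing R C).toNonUnitalRingHom :=
  Function.surjective_id.denseRange

section Alpha

variable {M : Type w₁} [AddCommGroup M] [Module Rᵐᵒᵖ M]

theorem alpha_map {M' : Type w₂} [AddCommGroup M'] [Module Rᵐᵒᵖ M'] (φ : M →ₗ[Rᵐᵒᵖ] M')
    (t : Tensor R M C) (a : A) :
    alpha κ (Tensor.map R φ LinearMap.id t) a = φ (alpha κ t a) :=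
  LeftDual.evalRight_map φ _ t

theorem alpha_mul (t : Tensor R M C) (a b : A) :
    alpha κ t (a * b) =
      alpha κ (Tensor.map R LinearMap.id (κ.toNonUnitalRingHom a).act t) b := by
  rw [alpha, map_mul, LeftDual.evalRight_mul_eq, alpha]

theorem alpha_injective (hκ : DenseRange κ.toNonUnitalRingHom) (hC : IsLocallyProjective R C) :
    Function.Injective (alpha κ : Tensor R M C → A → M) := by
  refine fun s t hst => hC.eq_of_evalRight_eq fun f => ?_
  obtain ⟨a, hs, ht⟩ := exists_of_denseRange_of_eventually_nhds hκ
    ((LeftDual.eventually_evalRight_eq f s).and (LeftDual.eventually_evalRight_eq f t))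
  exact hs.symm.trans ((congrFun hst a).trans ht)

end Alpha

namespace RightMod

variable {M : RightMod.{u, v, w₁} R A} {l : Filter A} [l.NeBot]

theorem isUnital_of_eventually_act_eq (h : ∀ m, ∀ᶠ a in l, M.act m a = m) : M.IsUnital := by
  refine (AddSubgroup.eq_top_iff' _).2 fun m => AddSubgroup.subset_closure ?_
  obtain ⟨a, ha⟩ := (h m).exists
  exact ⟨m, a, ha.symm⟩

theorem isFaithful_of_eventually_act_eq (h : ∀ m, ∀ᶠ a in l, M.act m a = m) :
    M.IsFaithful := by
  intro m n hmn
  obtain ⟨a, hm, hn⟩ := ((h m).and (h n)).exists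
  exact hm.symm.trans ((congrFun hmn a).trans hn)

end RightMod

section ApproximateUnit

variable {M : RightMod.{u, v, w} R A}

theorem eventually_act_eq_of_isFaithful (hM : M.IsFaithful) {m : M.carrier}
    (hm : m ∈ ratPart κ M) :
    ∀ᶠ e in comap κ.toNonUnitalRingHom (𝓝 (LeftDual.counit R C)), M.act m e = m := by
  obtain ⟨t, ht⟩ := hm
  filter_upwards [(LeftDual.eventually_map_act_eq (LeftDual.counit R C) t).comap
    κ.toNonUnitalRingHom] with e he
  refine hM (funext fun b => ?_)
  calc M.act (M.act m e) b = alpha κ t (e * b) := by rw [← M.act_mul, ht]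
    _ = alpha κ t b := by rw [alpha_mul, he, LeftDual.map_counit_act]
    _ = M.act m b := (ht b).symm

theorem eventually_act_act_eq {m : M.carrier} (hm : m ∈ ratPart κ M) (a : A) :
    ∀ᶠ e in comap κ.toNonUnitalRingHom (𝓝 (LeftDual.counit R C)),
      M.act (M.act m a) e = M.act m a := by
  obtain ⟨t, ht⟩ := hm
  filter_upwards [(LeftDual.eventually_evalRight_mul_eq (κ.toNonUnitalRingHom a) t).comap
    κ.toNonUnitalRingHom] with e he
  rw [← M.act_mul, ht, ht, alpha, map_mul, he, alpha]

theorem eventually_act_eq_of_isUnital (hM : M.IsUnital) (hrat : ratPart κ M = Set.univ)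
    (m : M.carrier) :
    ∀ᶠ e in comap κ.toNonUnitalRingHom (𝓝 (LeftDual.counit R C)), M.act m e = m := by
  have hm : m ∈ AddSubgroup.closure {x | ∃ m a, x = M.act m a} := hM ▸ AddSubgroup.mem_top m
  induction hm using AddSubgroup.closure_induction with
  | mem x hx =>
    obtain ⟨n, a, rfl⟩ := hx
    exact eventually_act_act_eq (Set.eq_univ_iff_forall.1 hrat n) a
  | zero => simp only [map_zero, AddMonoidHom.zero_apply, eventually_true]
  | add x y _ _ hx hy =>
    filter_upwards [hx, hy] with e hex hey
    rw [map_add, AddMonoidHom.add_apply, hex, hey]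
  | neg x _ hx =>
    filter_upwards [hx] with e hex
    rw [map_neg, AddMonoidHom.neg_apply, hex]

theorem ratFaithful_eq_ratUnital (hκ : DenseRange κ.toNonUnitalRingHom) :
    ratFaithful κ = ratUnital κ := by
  have := neBot_comap_nhds_of_denseRange hκ (LeftDual.counit R C)
  ext M
  refine and_congr_left fun hrat => ⟨fun hM => ?_, fun hM => ?_⟩
  · exact RightMod.isUnital_of_eventually_act_eq fun m =>
      eventually_act_eq_of_isFaithful hM (Set.eq_univ_iff_forall.1 hrat m)
  · exact RightMod.isFaithful_of_eventually_act_eq fun m =>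
      eventually_act_eq_of_isUnital hM hrat m

end ApproximateUnit

namespace RightMod

variable {K N : RightMod.{u, v, w} R A} {Λ : Type w}

/-- The inclusion of the summand of index `i` into the direct sum. -/
noncomputable def single (i : Λ) : K ⟶ K.directSum Λ where
  toLin := Finsupp.lsingle i
  map_act _ a := (Finsupp.mapRange_single (hf := map_zero (K.act.flip a))).symm

/-- The morphism from the direct sum given by a family of morphisms. -/
noncomputable def desc (φ : Λ → (K ⟶ N)) : K.directSum Λ ⟶ N where
  toLin := Finsupp.lsum ℕ fun i => (φ i).toLin
  map_act x a :=
    calc Finsupp.lsum ℕ (fun i => (φ i).toLin) ((K.directSum Λ).act x a)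
        = Finsupp.sum x fun i k => (φ i).toLin (K.act k a) :=
          Finsupp.sum_mapRange_index (hf := map_zero (K.act.flip a)) fun i => map_zero (φ i).toLin
      _ = Finsupp.sum x fun i k => N.act ((φ i).toLin k) a := by simp only [(φ _).map_act]
      _ = N.act (Finsupp.lsum ℕ (fun i => (φ i).toLin) x) a :=
          (map_finsuppSum (N.act.flip a) x fun i k => (φ i).toLin k).symm

theorem desc_single (φ : Λ → (K ⟶ N)) (i : Λ) (k : K.carrier) :
    (desc φ).toLin (Finsupp.single i k) = (φ i).toLin k :=
  Finsupp.sum_single_index (h := fun i k => (φ i).toLin k) (map_zero (φ i).toLin)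

end RightMod

section RationalPart

variable {M N : RightMod.{u, v, w} R A}

theorem zero_mem_ratPart : 0 ∈ ratPart κ M :=
  ⟨0, fun a => by rw [alpha, map_zero, map_zero, AddMonoidHom.zero_apply]⟩

theorem add_mem_ratPart {m n : M.carrier} (hm : m ∈ ratPart κ M) (hn : n ∈ ratPart κ M) :
    m + n ∈ ratPart κ M := by
  obtain ⟨s, hs⟩ := hm
  obtain ⟨t, ht⟩ := hn
  exact ⟨s + t, fun a => by rw [map_add, AddMonoidHom.add_apply, hs, ht, add_alpha]⟩

theorem map_mem_ratPart (f : M ⟶ N) {m : M.carrier} (hm : m ∈ ratPart κ M) :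
    f.toLin m ∈ ratPart κ N := by
  obtain ⟨t, ht⟩ := hm
  exact ⟨Tensor.map R f.toLin LinearMap.id t, fun a => by rw [← f.map_act, ht, alpha_map]⟩

theorem mem_ratPart_of_injective (hκ : DenseRange κ.toNonUnitalRingHom)
    (hC : IsLocallyProjective R C) (i : M ⟶ N) (hi : Function.Injective i.toLin) {m : M.carrier}
    (hm : i.toLin m ∈ ratPart κ N) : m ∈ ratPart κ M := by
  obtain ⟨t, ht⟩ := hm
  have hvalues : ∀ f : LeftDual R C, ∃ n, i.toLin n = Tensor.evalRight R f.toLin t := fun f => by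
    obtain ⟨a, ha⟩ := exists_of_denseRange_of_eventually_nhds hκ
      (LeftDual.eventually_evalRight_eq f t)
    exact ⟨M.act m a, (i.map_act m a).trans ((ht a).trans ha)⟩
  obtain ⟨s, rfl⟩ := hC.exists_map_eq i.toLin hvalues
  exact ⟨s, fun a => hi (by rw [i.map_act, ht, alpha_map])⟩

theorem ratPart_directSum (hM : ratPart κ M = Set.univ) (Λ : Type w) :
    ratPart κ (M.directSum Λ) = Set.univ := by
  refine Set.eq_univ_of_forall fun x => ?_
  induction x using Finsupp.induction_linear with
  | zero => exact zero_mem_ratPart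
  | add x y hx hy => exact add_mem_ratPart hx hy
  | single i m => exact map_mem_ratPart (RightMod.single i) (Set.eq_univ_iff_forall.1 hM m)

theorem ratPart_eq_univ_of_isSubgenerated (hκ : DenseRange κ.toNonUnitalRingHom)
    (hC : IsLocallyProjective R C) (hM : ratPart κ M = Set.univ) (hN : M.IsSubgenerated N) :
    ratPart κ N = Set.univ := by
  obtain ⟨G, i, ⟨Λ, p, hp⟩, hi⟩ := hN
  refine Set.eq_univ_of_forall fun n => mem_ratPart_of_injective hκ hC i hi ?_
  obtain ⟨x, hx⟩ := hp (i.toLin n)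
  rw [← hx]
  exact map_mem_ratPart p (Set.eq_univ_iff_forall.1 (ratPart_directSum hM Λ) x)

theorem ratPart_comodToMod (κ : RRingHom R A (LeftDual R C)) (M : Comod R C) :
    ratPart κ ((comodToMod κ).obj M) = Set.univ :=
  Set.eq_univ_of_forall fun m => ⟨M.coact m, fun _ => rfl⟩

end RationalPart

section Coaction

variable {M : RightMod.{u, v, w} R A}

theorem exists_coact (hκ : DenseRange κ.toNonUnitalRingHom) (hC : IsLocallyProjective R C)
    (hM : ratPart κ M = Set.univ) :
    ∃ ϱ : M.carrier →ₗ[Rᵐᵒᵖ] Tensor R M.carrier C, ∀ m a, M.act m a = alpha κ (ϱ m) a := by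
  choose ϱ hϱ using Set.eq_univ_iff_forall.1 hM
  refine ⟨{ toFun := ϱ, map_add' := fun m n => ?_, map_smul' := fun r m => ?_ }, hϱ⟩
  · refine alpha_injective hκ hC (funext fun a => ?_)
    rw [← hϱ, map_add, AddMonoidHom.add_apply, hϱ, hϱ, add_alpha]
  · refine alpha_injective hκ hC (funext fun a => ?_)
    calc alpha κ (ϱ (r • m)) a = M.act (r • m) a := (hϱ _ a).symm
      _ = M.act m (r.unop • a) := M.op_smul_act m a r.unop
      _ = alpha κ (r • ϱ m) a := (hϱ m _).trans (op_smul_alpha κ (ϱ m) a r.unop).symm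

variable {ϱ : M.carrier →ₗ[Rᵐᵒᵖ] Tensor R M.carrier C}

theorem coact_injective (hM : M.IsFaithful) (hϱ : ∀ m a, M.act m a = alpha κ (ϱ m) a) :
    Function.Injective ϱ := fun m n hmn =>
  hM (funext fun a => (hϱ m a).trans ((congrArg (alpha κ · a) hmn).trans (hϱ n a).symm))

theorem coact_act (hκ : DenseRange κ.toNonUnitalRingHom) (hC : IsLocallyProjective R C)
    (hϱ : ∀ m a, M.act m a = alpha κ (ϱ m) a) (m : M.carrier) (a : A) :
    ϱ (M.act m a) = Tensor.map R LinearMap.id (κ.toNonUnitalRingHom a).act (ϱ m) :=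
  alpha_injective hκ hC (funext fun b => by rw [← hϱ, ← M.act_mul, hϱ, alpha_mul])

theorem coact_coassoc (hκ : DenseRange κ.toNonUnitalRingHom) (hC : IsLocallyProjective R C)
    (hϱ : ∀ m a, M.act m a = alpha κ (ϱ m) a) (m : M.carrier) :
    Tensor.assoc R (Tensor.map R ϱ LinearMap.id (ϱ m)) =
      Tensor.map R LinearMap.id (comulLeft R C) (ϱ m) := by
  refine hC.coassoc_of_coact_evalRight ϱ fun f => ?_
  obtain ⟨a, hvalue, hact⟩ := exists_of_denseRange_of_eventually_nhds hκ
    ((LeftDual.eventually_evalRight_eq f (ϱ m)).and (LeftDual.eventually_map_act_eq f (ϱ m)))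
  calc ϱ (Tensor.evalRight R f.toLin (ϱ m)) = ϱ (M.act m a) := by rw [← hvalue, hϱ, alpha]
    _ = Tensor.map R LinearMap.id f.act (ϱ m) := by rw [coact_act hκ hC hϱ, hact]

end Coaction

section Subgeneration

/-- `M ⊗_R C` as a right `A`-module, with `A` acting on the second factor. -/
def tensorMod (κ : RRingHom R A (LeftDual R C)) (M : Type w₁) [AddCommGroup M] [Module Rᵐᵒᵖ M] :
    RightMod.{u, v, max w₁ w} R A where
  carrier := Tensor R M C
  act := AddMonoidHom.flip (AddMonoidHom.mk'
    (fun a => Tensor.map R LinearMap.id (κ.toNonUnitalRingHom a).act)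
    (fun a b => Tensor.addHom_ext R fun m c =>
      (congrArg (Tensor.tmul R m) (alpha_add κ (Coring.comul c) a b)).trans
        (Tensor.tmul_add R m _ _)))
  act_op_smul t a r :=
    Tensor.addHom_congr R (Tensor.map R LinearMap.id (κ.toNonUnitalRingHom (op r • a)).act)
      ((Tensor.rsmul R (op r)).comp (Tensor.map R LinearMap.id (κ.toNonUnitalRingHom a).act)) t
      fun m c => congrArg (Tensor.tmul R m) ((coringMod κ).act_op_smul c a r)
  op_smul_act t a r :=
    Tensor.addHom_congr R
      ((Tensor.map R LinearMap.id (κ.toNonUnitalRingHom a).act).comp (Tensor.rsmul R (op r)))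
      (Tensor.map R LinearMap.id (κ.toNonUnitalRingHom (r • a)).act) t
      fun m c => congrArg (Tensor.tmul R m) ((coringMod κ).op_smul_act c a r)
  act_mul t a b :=
    Tensor.addHom_congr R (Tensor.map R LinearMap.id (κ.toNonUnitalRingHom (a * b)).act)
      ((Tensor.map R LinearMap.id (κ.toNonUnitalRingHom b).act).comp
        (Tensor.map R LinearMap.id (κ.toNonUnitalRingHom a).act)) t
      fun m c => congrArg (Tensor.tmul R m) ((coringMod κ).act_mul c a b)

/-- The morphism `c ↦ m ⊗ c` from `C` to `M ⊗_R C`. -/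
def tmulHom (κ : RRingHom R A (LeftDual R C)) {M : Type w} [AddCommGroup M] [Module Rᵐᵒᵖ M]
    (m : M) : coringMod κ ⟶ tensorMod κ M where
  toLin := ({ Tensor.mk R (N := C) m with map_smul' := fun _ _ => rfl } :
    C →ₗ[Rᵐᵒᵖ] Tensor R M C)
  map_act _ _ := rfl

theorem isGenerated_tensorMod (κ : RRingHom R A (LeftDual R C)) (M : Type w) [AddCommGroup M]
    [Module Rᵐᵒᵖ M] : (coringMod κ).IsGenerated (tensorMod κ M) := by
  refine ⟨M, RightMod.desc (tmulHom κ), fun t => ?_⟩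
  change t ∈ LinearMap.range (RightMod.desc (tmulHom κ)).toLin
  induction t using Tensor.induction with
  | tmul m c => exact ⟨Finsupp.single m c, RightMod.desc_single (tmulHom κ) m c⟩
  | zero => exact zero_mem _
  | add x y hx hy => exact add_mem hx hy

theorem isSubgenerated_of_ratFaithful (hκ : DenseRange κ.toNonUnitalRingHom)
    (hC : IsLocallyProjective R C) {M : RightMod.{u, v, w} R A} (hM : ratFaithful κ M) :
    (coringMod κ).IsSubgenerated M := by
  obtain ⟨ϱ, hϱ⟩ := exists_coact hκ hC hM.2
  exact ⟨tensorMod κ M.carrier, ⟨ϱ, coact_act hκ hC hϱ⟩, isGenerated_tensorMod κ M.carrier,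
    coact_injective hM.1 hϱ⟩

theorem ratUnital_eq_sigma (hκ : DenseRange κ.toNonUnitalRingHom)
    (hC : IsLocallyProjective R C) : ratUnital κ = (coringMod κ).sigma := by
  ext M
  refine and_congr_right fun hM => ⟨fun hrat => ?_, fun hsub => ?_⟩
  · refine isSubgenerated_of_ratFaithful hκ hC ?_
    rw [ratFaithful_eq_ratUnital hκ]
    exact ⟨hM, hrat⟩
  · exact ratPart_eq_univ_of_isSubgenerated hκ hC (ratPart_comodToMod κ _) hsub

end Subgeneration

namespace IsCatIso

variable {𝒞 : Type w₁} {𝒟 : Type w₂} [Category.{w₃} 𝒞] [Category.{w₄} 𝒟] {F : 𝒞 ⥤ 𝒟}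

theorem of_bijective [F.Full] [F.Faithful] (hF : Function.Bijective F.obj) : IsCatIso F := by
  obtain ⟨g, hgF, hFg⟩ := Function.bijective_iff_has_inverse.1 hF
  let G : 𝒟 ⥤ 𝒞 :=
    { obj := g
      map := fun {X Y} f => F.preimage (eqToHom (hFg X) ≫ f ≫ eqToHom (hFg Y).symm)
      map_id := fun X => F.map_injective (by simp)
      map_comp := fun f g => F.map_injective (by simp) }
  refine ⟨G, ?_, ?_⟩
  · exact CategoryTheory.Functor.ext hgF fun X Y f => F.map_injective (by simp [G, eqToHom_map])
  · exact CategoryTheory.Functor.ext hFg fun X Y f => by simp [G]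

theorem of_comp {ℰ : Type*} [Category* ℰ] {G : 𝒟 ⥤ ℰ} (hF : IsCatIso F)
    (hFG : IsCatIso (F ⋙ G)) : IsCatIso G := by
  obtain ⟨F', _, hF'F⟩ := hF
  obtain ⟨H, hFGH, hHFG⟩ := hFG
  refine ⟨H ⋙ F, ?_, hHFG⟩
  calc G ⋙ H ⋙ F = (F' ⋙ F) ⋙ G ⋙ H ⋙ F := by rw [hF'F, Functor.id_comp]
    _ = F' ⋙ ((F ⋙ G) ⋙ H) ⋙ F := rfl
    _ = 𝟭 𝒟 := by rw [hFGH, Functor.id_comp, hF'F]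

end IsCatIso

section Comparison

theorem ratFaithful_comodToMod (hκ : DenseRange κ.toNonUnitalRingHom)
    (hC : IsLocallyProjective R C) (M : Comod R C) : ratFaithful κ ((comodToMod κ).obj M) :=
  ⟨fun _ _ h => M.counital (alpha_injective hκ hC h), ratPart_comodToMod κ M⟩

theorem exists_comodToMod_obj_eq (hκ : DenseRange κ.toNonUnitalRingHom)
    (hC : IsLocallyProjective R C) {M : RightMod.{u, v, w} R A} (hM : ratFaithful κ M) :
    ∃ N : Comod R C, (comodToMod κ).obj N = M := by
  obtain ⟨ϱ, hϱ⟩ := exists_coact hκ hC hM.2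
  let N : Comod R C := ⟨M.carrier, ϱ, coact_coassoc hκ hC hϱ, coact_injective hM.1 hϱ⟩
  have hact : ((comodToMod κ).obj N).act = M.act := by
    ext m a
    exact (hϱ m a).symm
  cases M
  exact ⟨N, (RightMod.mk.injEq ..).mpr ⟨rfl, HEq.rfl, HEq.rfl, heq_of_eq hact⟩⟩

theorem comodToMod_obj_injective (hκ : DenseRange κ.toNonUnitalRingHom)
    (hC : IsLocallyProjective R C) : Function.Injective (comodToMod κ).obj := by
  rintro ⟨M, ϱ⟩ ⟨N, ϱ'⟩ h
  obtain ⟨rfl, hadd, hmod, hact⟩ := RightMod.mk.inj h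
  obtain rfl := eq_of_heq hadd
  obtain rfl := eq_of_heq hmod
  congr
  ext m
  refine alpha_injective hκ hC (funext fun a => ?_)
  exact DFunLike.congr_fun (DFunLike.congr_fun (eq_of_heq hact) m) a

theorem isCatIso_comodToMod (hκ : DenseRange κ.toNonUnitalRingHom)
    (hC : IsLocallyProjective R C) :
    IsCatIso ((ratFaithful κ).lift (comodToMod κ) (ratFaithful_comodToMod hκ hC)) := by
  set F := (ratFaithful κ).lift (comodToMod κ) (ratFaithful_comodToMod hκ hC)
  have : F.Full := ⟨fun {M N} f => ⟨⟨f.hom.toLin, fun m => alpha_injective hκ hC (funext fun a =>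
    (f.hom.map_act m a).symm.trans (alpha_map f.hom.toLin (M.coact m) a).symm)⟩, rfl⟩⟩
  have : F.Faithful :=
    ⟨fun {M N} f g h => Comod.Hom.ext (congrArg (fun f => f.hom.toLin) h)⟩
  refine IsCatIso.of_bijective ⟨fun M N h => ?_, fun M => ?_⟩
  · exact comodToMod_obj_injective hκ hC (congrArg ObjectProperty.FullSubcategory.obj h)
  · obtain ⟨N, hN⟩ := exists_comodToMod_obj_eq hκ hC M.property
    exact ⟨N, ObjectProperty.FullSubcategory.ext hN⟩

theorem ratFaithful_restrict (hκ : DenseRange κ.toNonUnitalRingHom)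
    (hC : IsLocallyProjective R C) {M : RightMod.{u, max u w, w} R (LeftDual R C)}
    (hM : ratFaithful (selfPairing R C) M) : ratFaithful κ ((RightMod.restrict κ).obj M) := by
  obtain ⟨N, rfl⟩ := exists_comodToMod_obj_eq denseRange_selfPairing hC hM
  exact ratFaithful_comodToMod hκ hC N

theorem isCatIso_restrict (hκ : DenseRange κ.toNonUnitalRingHom)
    (hC : IsLocallyProjective R C) :
    IsCatIso ((ratFaithful κ).lift ((ratFaithful (selfPairing R C)).ι ⋙ RightMod.restrict κ)
      fun M => ratFaithful_restrict hκ hC M.property) :=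
  (isCatIso_comodToMod denseRange_selfPairing hC).of_comp (isCatIso_comodToMod hκ hC)

end Comparison

end Pairing

end CoringPairing

theorem mainTheorem3 {R : Type u} {A : Type v} {C : Type w} [Ring R]
    [NonUnitalRing A] [Module R A] [Module Rᵐᵒᵖ A] [CoringPairing.RRing R A]
    [AddCommGroup C] [Module R C] [Module Rᵐᵒᵖ C] [SMulCommClass R Rᵐᵒᵖ C]
    [CoringPairing.Coring R C]
    (κ : CoringPairing.RRingHom R A (CoringPairing.LeftDual R C))
    (hC : CoringPairing.IsLocallyProjective R C)
    (hκ : @Dense (CoringPairing.LeftDual R C) (CoringPairing.finiteTopology R C)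
      (Set.range κ.toNonUnitalRingHom)) :
    -- the first row, for `A`
    (∃ h : ∀ M, CoringPairing.ratFaithful κ ((CoringPairing.comodToMod κ).obj M),
      CoringPairing.IsCatIso
        ((CoringPairing.ratFaithful κ).lift (CoringPairing.comodToMod κ) h)) ∧
    CoringPairing.ratFaithful κ = CoringPairing.ratUnital κ ∧
    CoringPairing.ratUnital κ = (CoringPairing.coringMod κ).sigma ∧
    -- the second row, for `*C`
    (∃ h : ∀ M, CoringPairing.ratFaithful (CoringPairing.selfPairing R C) ((CoringPairing.comodToMod (CoringPairing.selfPairing R C)).obj M),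
      CoringPairing.IsCatIso
        ((CoringPairing.ratFaithful (CoringPairing.selfPairing R C)).lift (CoringPairing.comodToMod (CoringPairing.selfPairing R C)) h)) ∧
    CoringPairing.ratFaithful (CoringPairing.selfPairing R C) = CoringPairing.ratUnital (CoringPairing.selfPairing R C) ∧
    CoringPairing.ratUnital (CoringPairing.selfPairing R C) = (CoringPairing.coringMod (CoringPairing.selfPairing R C)).sigma ∧
    -- restriction of scalars along `κ` identifies the second row with the first
    (∃ h : ∀ M : (CoringPairing.ratFaithful (CoringPairing.selfPairing R C)).FullSubcategory,
        (CoringPairing.coringMod κ).sigma ((CoringPairing.RightMod.restrict κ).obj M.obj),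
      CoringPairing.IsCatIso ((CoringPairing.coringMod κ).sigma.lift
        ((CoringPairing.ratFaithful (CoringPairing.selfPairing R C)).ι ⋙ CoringPairing.RightMod.restrict κ) h)) := by
  refine ⟨⟨_, CoringPairing.isCatIso_comodToMod hκ hC⟩,
    CoringPairing.ratFaithful_eq_ratUnital hκ, CoringPairing.ratUnital_eq_sigma hκ hC,
    ⟨_, CoringPairing.isCatIso_comodToMod CoringPairing.denseRange_selfPairing hC⟩,
    CoringPairing.ratFaithful_eq_ratUnital CoringPairing.denseRange_selfPairing,
    CoringPairing.ratUnital_eq_sigma CoringPairing.denseRange_selfPairing hC, ?_⟩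
  rw [← CoringPairing.ratUnital_eq_sigma hκ hC, ← CoringPairing.ratFaithful_eq_ratUnital hκ]
  exact ⟨_, CoringPairing.isCatIso_restrict hκ hC⟩
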